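/- Let $\mathbb F=\mathbb Z/2$. All homology has coefficients in $\mathbb F$. Graphs are finite, and loops and multiple edges are allowed. **Notation.** Let $X$ be a simplicial complex on a finite vertex set, and let $\varepsilon$ be a colouring of its vertices by $0$ (white) and $1$ (black). For a simplex $\sigma$ let $w_\varepsilon(\sigma)$ be the number of white vertices of $\sigma$. The horizontal homology $\mathrm H^h_i(X,\varepsilon,k)$ is the degree-$i$ homology of the complex spanned by the simplices $\sigma$ of $X$ with $w_\varepsilon(\sigma)=k$, graded by dimension, whose differential $\partial_h\sigma$ is the sum of the codimension-one faces $\tau$ of $\sigma$ with $w_\varepsilon(\tau)=w_\varepsilon(\sigma)$. Reduced homology $\widetilde{\mathrm H}_*(X)$ is computed from the simplicial chain complex augmented by one generator in degree $-1$, the boundary of every vertex; so $\widetilde{\mathrm H}_*(\emptyset)=\mathbb F$ in degree $-1$. A matching on a graph $H$ is a set of pairwise disjoint edges. $\mathrm{Match}(H)$ is the set of matchings on $H$, and the matching complex $\mathrm M(H)$ is the simplicial complex whose vertices are the edges of $H$ and whose simplices are the nonempty matchings. $B(H)$ is the barycentric subdivision of $H$: each edge is subdivided once, so the edges of $B(H)$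 are the half-edges of $H$. Let $G$ be a connected plane graph and $G^*$ a plane dual of $G$, drawn together with $G$: each face of either graph contains exactly one vertex of the other, each edge $e$ of $G$ meets its dual edge $e^*$ in exactly one point, and $G$ and $G^*$ have no other points in common. The overlaid Tait graph $\Gamma(G)$ is obtained by overlaying $G$ and $G^*$. Its vertices are $V(G)\sqcup V(G^*)\sqcup\{e\cap e^* : e\in E(G)\}$, and its edges are the half-edges of $G$ and of $G^*$ cut off at the points $e\cap e^*$. The colouring $\varepsilon_G$ of the edges of $\Gamma(G)$, i.e. of the vertices of $\mathrm M(\Gamma(G))$, is black on the edges with an endpoint in $V(G)$ and white on those with an endpoint in $V(G^*)$. For $m\in\mathrm{Match}(B(G^*))$ let $G(m)$ be the subgraph of $G$ obtained by removing every edge $e$ such that the barycentre of $e^*$ is matched by $m$ (all vertices are kept); $G(m)=\emptyset$ means that $G(m)$ has no edges. Write $\mathbb F_{(a,k)}$ for a copy of $\mathbb F$ in dimension degree $a$ and filtration degree $k$. **Theorem.** For every $k>0$ and every integer $i$ there is an isomorphism of $\mathbb F$-vector spaces $$\mathrm H^h_i(\mathrm M(\Gamma(G)),\varepsilon_G,k)\;\cong\;\bigoplus_{\substack{m\in\mathrm{Match}(B(G^*))\\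 |m|=k,\ G(m)\neq\emptyset}}\widetilde{\mathrm H}_{i-k}\bigl(\mathrm M(B(G(m)))\bigr)\;\oplus\bigoplus_{\substack{m\in\mathrm{Match}(B(G^*))\\ |m|=k,\ G(m)=\emptyset}}\bigl(\mathbb F_{(k-1,k)}\bigr)_i ,$$ where $(\mathbb F_{(k-1,k)})_i$ is $\mathbb F$ if $i=k-1$ and $0$ otherwise. For $k=0$ and every integer $i$, $$\mathrm H^h_i(\mathrm M(\Gamma(G)),\varepsilon_G,0)\;\cong\;\mathrm H_i\bigl(\mathrm M(B(G))\bigr).$$ -/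

import Mathlib

open CategoryTheory
open scoped DirectSum

namespace TaitMatching

/-! ### Chain complexes over the field with two elements -/

/-- The field with two elements. -/
abbrev F : Type := ZMod 2

section Chains

variable {α : Type}

/-- The members of `S` of dimension `i`, i.e. with exactly `i + 1` elements.
The empty set, if it belongs to `S`, is the only one of dimension `-1`. -/
abbrev Cell (S : Set (Finset α)) (i : ℤ) : Type :=
  {σ : Finset α // σ ∈ S ∧ (σ.card : ℤ) = i + 1}

open Classical in
/-- The boundary map `σ ↦ ∑ τ`, the sum being over the codimension one faces `τ = σ \ {v}` of `σ`
that belong to `S` (and have dimension `j`, which is automatic for `j = i - 1` and impossible for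
other `j`). -/
noncomputable def boundaryMap (S : Set (Finset α)) (i j : ℤ) :
    (Cell S i →₀ F) →ₗ[F] (Cell S j →₀ F) :=
  Finsupp.linearCombination F fun σ : Cell S i =>
    ∑ v ∈ σ.1, if h : σ.1.erase v ∈ S ∧ ((σ.1.erase v).card : ℤ) = j + 1 then
      Finsupp.single (⟨σ.1.erase v, h⟩ : Cell S j) (1 : F) else 0

theorem boundaryMap_shape (S : Set (Finset α)) (i j : ℤ) (hij : j + 1 ≠ i) :
    boundaryMap S i j = 0 := by
  classical
  refine Finsupp.lhom_ext' fun σ => LinearMap.ext_ring ?_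
  simp only [boundaryMap, LinearMap.comp_apply, Finsupp.lsingle_apply,
    Finsupp.linearCombination_single, one_smul, LinearMap.zero_apply]
  refine Finset.sum_eq_zero fun v hv => dif_neg ?_
  rintro ⟨-, h⟩
  have h2 := σ.2.2
  have h3 := Finset.card_erase_add_one hv
  apply hij
  omega

theorem boundaryMap_comp (S : Set (Finset α)) (hS : S.OrdConnected) (i j k : ℤ) :
    (boundaryMap S j k).comp (boundaryMap S i j) = 0 := by
  classical
  refine Finsupp.lhom_ext' fun σ => LinearMap.ext_ring ?_
  simp only [boundaryMap, LinearMap.comp_apply, Finsupp.lsingle_apply,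
    Finsupp.linearCombination_single, one_smul, LinearMap.zero_apply, map_sum]
  have key : ∀ v ∈ σ.1, (Finsupp.linearCombination F fun ρ : Cell S j =>
      ∑ w ∈ ρ.1, if h : ρ.1.erase w ∈ S ∧ ((ρ.1.erase w).card : ℤ) = k + 1 then
        Finsupp.single (⟨ρ.1.erase w, h⟩ : Cell S k) (1 : F) else 0)
      (if h : σ.1.erase v ∈ S ∧ ((σ.1.erase v).card : ℤ) = j + 1 then
        Finsupp.single (⟨σ.1.erase v, h⟩ : Cell S j) (1 : F) else 0) =
      ∑ w ∈ σ.1.erase v, if h : ((σ.1.erase v).erase w ∈ S ∧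
          (((σ.1.erase v).erase w).card : ℤ) = k + 1) ∧ i = j + 1 then
        Finsupp.single (⟨(σ.1.erase v).erase w, h.1⟩ : Cell S k) (1 : F) else 0 := by
    intro v hv
    have h2 := σ.2.2
    have h3 := Finset.card_erase_add_one hv
    by_cases hc : σ.1.erase v ∈ S ∧ ((σ.1.erase v).card : ℤ) = j + 1
    · rw [dif_pos hc, Finsupp.linearCombination_single, one_smul]
      have hij : i = j + 1 := by omega
      refine Finset.sum_congr rfl fun w _ => ?_
      by_cases hd : (σ.1.erase v).erase w ∈ S ∧ (((σ.1.erase v).erase w).card : ℤ) = k + 1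
      · rw [dif_pos hd, dif_pos ⟨hd, hij⟩]
      · rw [dif_neg hd, dif_neg fun h => hd h.1]
    · rw [dif_neg hc, map_zero]
      refine (Finset.sum_eq_zero fun w _ => dif_neg ?_).symm
      rintro ⟨⟨hd, -⟩, hij⟩
      refine hc ⟨hS.out hd σ.2.1 ⟨Finset.erase_subset _ _, Finset.erase_subset _ _⟩, ?_⟩
      omega
  rw [Finset.sum_congr rfl key, Finset.sum_sigma']
  refine Finset.sum_involution (fun p _ => ⟨p.2, p.1⟩) ?_ ?_ ?_ ?_
  · rintro ⟨v, w⟩ -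
    have hcomm : (σ.1.erase w).erase v = (σ.1.erase v).erase w := Finset.erase_right_comm
    simp only [hcomm]
    rw [← two_smul F, show (2 : F) = 0 from rfl, zero_smul]
  · rintro ⟨v, w⟩ hp - heq
    simp only [Finset.mem_sigma, Finset.mem_erase] at hp
    exact hp.2.1 (Sigma.mk.inj_iff.1 heq).1
  · rintro ⟨v, w⟩ hp
    simp only [Finset.mem_sigma, Finset.mem_erase] at hp ⊢
    exact ⟨hp.2.2, hp.2.1.symm, hp.1⟩
  · rintro ⟨v, w⟩ -
    rfl

/-- The chain complex over `F` generated by an order-convex family `S` of finite sets, where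
a set with `i + 1` elements sits in degree `i` and the differential is the sum of all codimension
one faces that lie in `S`. -/
noncomputable def cellComplex (S : Set (Finset α)) (hS : S.OrdConnected) :
    ChainComplex (ModuleCat F) ℤ where
  X i := ModuleCat.of F (Cell S i →₀ F)
  d i j := ModuleCat.ofHom (boundaryMap S i j)
  shape i j hij := by
    rw [boundaryMap_shape S i j hij]
    rfl
  d_comp_d' i j k _ _ := by
    rw [← ModuleCat.ofHom_comp, boundaryMap_comp S hS]
    rfl

/-! ### Simplicial, reduced and horizontal homology -/

theorem ordConnected_faces (X : PreAbstractSimplicialComplex α) : X.faces.OrdConnected :=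
  ⟨fun _ hx _ hy _ hz =>
    (X.isRelLowerSet_faces hy).2 hz.2 ((X.isRelLowerSet_faces hx).1.mono hz.1)⟩

theorem ordConnected_insert_empty (X : PreAbstractSimplicialComplex α) :
    (insert ∅ X.faces).OrdConnected := by
  refine ⟨fun x hx y hy z hz => ?_⟩
  rcases z.eq_empty_or_nonempty with rfl | hne
  · exact Set.mem_insert _ _
  rcases hy with rfl | hy
  · exact absurd (Finset.subset_empty.1 hz.2) hne.ne_empty
  · exact Set.mem_insert_of_mem _ ((X.isRelLowerSet_faces hy).2 hz.2 hne)

/-- The weight `w_ε(σ)`: the number of white vertices of `σ`, a vertex `v` being white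
if `ε v = 0` and black if `ε v = 1`. -/
def weight (ε : α → ZMod 2) (σ : Finset α) : ℕ := (σ.filter fun v => ε v = 0).card

theorem ordConnected_weight (X : PreAbstractSimplicialComplex α) (ε : α → ZMod 2) (k : ℕ) :
    {σ | σ ∈ X.faces ∧ weight ε σ = k}.OrdConnected := by
  refine ⟨fun x hx y hy z hz => ⟨(ordConnected_faces X).out hx.1 hy.1 hz, le_antisymm ?_ ?_⟩⟩
  · rw [← hy.2]
    exact Finset.card_le_card (Finset.filter_subset_filter _ hz.2)
  · rw [← hx.2]
    exact Finset.card_le_card (Finset.filter_subset_filter _ hz.1)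

/-- Simplicial homology `H_i(X)` with coefficients in `F`. -/
noncomputable abbrev simplicialHomology (X : PreAbstractSimplicialComplex α) (i : ℤ) :
    ModuleCat F :=
  (cellComplex X.faces (ordConnected_faces X)).homology i

/-- Reduced simplicial homology of `X` in degree `i`, with coefficients in `F`: the chain complex is
augmented by one generator, the empty simplex, in degree `-1`, which is the boundary of
each vertex. -/
noncomputable abbrev reducedHomology (X : PreAbstractSimplicialComplex α) (i : ℤ) : ModuleCat F :=
  (cellComplex (insert ∅ X.faces) (ordConnected_insert_empty X)).homology i

/-- Horizontal homology `H^h_i(X, ε, k)` of an `ε`-coloured simplicial complex: the homology of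
the complex `C_*(X, ε, k)` spanned by the simplices with exactly `k` white vertices, where the
horizontal differential of `σ` is the sum of those codimension one faces of `σ` that have
as many white vertices as `σ`. -/
noncomputable abbrev horizontalHomology (X : PreAbstractSimplicialComplex α) (ε : α → ZMod 2)
    (k : ℕ) (i : ℤ) : ModuleCat F :=
  (cellComplex {σ | σ ∈ X.faces ∧ weight ε σ = k} (ordConnected_weight X ε k)).homology i

end Chains

/-- The degree `i` part of a copy of `F` placed in degree `a`. -/
def lineInDegree (a i : ℤ) : Submodule F F := if i = a then ⊤ else ⊥

/-! ### Matchings and the matching complex of a multigraph -/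

section Matchings

variable {α β : Type}

/-- A matching on `H`: a finite set of edges of `H`, no two of which share an endpoint. -/
def IsMatching (H : Graph α β) (m : Finset β) : Prop :=
  (m : Set β) ⊆ H.edgeSet ∧ ∀ e ∈ m, ∀ f ∈ m, e ≠ f → ∀ x, ¬ (H.Inc e x ∧ H.Inc f x)

/-- The matching complex `M(H)`: its vertices are the edges of `H`, its simplices are
the nonempty matchings on `H`. -/
def matchingComplex (H : Graph α β) : PreAbstractSimplicialComplex β where
  faces := {m | m.Nonempty ∧ IsMatching H m}
  isRelLowerSet_faces := fun _ hm => ⟨hm.1, fun _ hn hne => ⟨hne,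
    fun _ he => hm.2.1 (hn he), fun e he f hf => hm.2.2 e (hn he) f (hn hf)⟩⟩

/-- The multigraph with vertex set `V` and edge set all of `β`, in which the edge `e` joins
`a e` to `b e`. -/
def graphOfEnds (V : Set α) (a b : β → α) (ha : ∀ e, a e ∈ V) (hb : ∀ e, b e ∈ V) :
    Graph α β where
  vertexSet := V
  IsLink e x y := (x = a e ∧ y = b e) ∨ (x = b e ∧ y = a e)
  edgeSet := Set.univ
  isLink_symm e _ := ⟨fun x y h => h.symm.imp And.symm And.symm⟩
  eq_or_eq_of_isLink_of_isLink := by grind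
  edge_mem_iff_exists_isLink e := ⟨fun _ => ⟨a e, b e, Or.inl ⟨rfl, rfl⟩⟩, fun _ => trivial⟩
  left_mem_of_isLink := by
    rintro e x y (⟨rfl, -⟩ | ⟨rfl, -⟩)
    exacts [ha e, hb e]

end Matchings

/-! ### Plane graphs -/

/-- The Euclidean plane. -/
abbrev Plane : Type := EuclideanSpace ℝ (Fin 2)

/-- A finite plane (multi)graph: finitely many points of the plane (the vertices) and finitely many
arcs (the edges), given by parametrisations on `[0, 1]`. Each arc starts and ends at a vertex; the
open arcs `arc e (0, 1)` avoid the vertices, have no self-intersections and are pairwise disjoint.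
Loops and multiple edges are allowed. -/
structure PlaneGraph where
  /-- the set of vertices -/
  V : Set Plane
  finite_V : V.Finite
  /-- the index type of the edges -/
  E : Type
  finite_E : Finite E
  /-- the arc in the plane that is the edge `e` -/
  arc : E → C(unitInterval, Plane)
  arc_zero_mem : ∀ e, arc e 0 ∈ V
  arc_one_mem : ∀ e, arc e 1 ∈ V
  arc_interior_notMem : ∀ e, ∀ t ∈ Set.Ioo (0 : unitInterval) 1, arc e t ∉ V
  arc_interior_injective : ∀ e e', ∀ s ∈ Set.Ioo (0 : unitInterval) 1,
    ∀ t ∈ Set.Ioo (0 : unitInterval) 1, arc e s = arc e' t → e = e' ∧ s = t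

namespace PlaneGraph

variable (G : PlaneGraph)

/-- The endpoint of the edge `e` on its side `b`. The pairs `(e, b)` are the half-edges of `G`. -/
def endpoint (e : G.E) (b : Bool) : Plane := if b then G.arc e 1 else G.arc e 0

theorem endpoint_mem (e : G.E) (b : Bool) : G.endpoint e b ∈ G.V := by
  cases b
  · exact G.arc_zero_mem e
  · exact G.arc_one_mem e

/-- A plane graph is connected if it has a vertex and any two vertices are joined
by a walk. -/
def Connected : Prop :=
  G.V.Nonempty ∧ ∀ u ∈ G.V, ∀ v ∈ G.V,
    Relation.ReflTransGen (fun x y => ∃ e b, G.endpoint e b = x ∧ G.endpoint e (!b) = y) u v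

/-- The point set of the plane graph: the union of its vertices and edges. -/
def pointSet : Set Plane := G.V ∪ ⋃ e, Set.range (G.arc e)

/-- The faces of `G`: the connected components of the complement of `G` in the plane. -/
def faces : Set (Set Plane) :=
  {f | ∃ x ∈ G.pointSetᶜ, f = connectedComponentIn G.pointSetᶜ x}

/-- The first barycentric subdivision `B(G)`, as a multigraph: its vertices are the vertices
of `G` and one barycentre `Sum.inr e` for each edge `e` of `G`; its edges are the half-edges
of `G`, the half-edge `(e, b)` joining the endpoint of `e` on the side `b` to the
barycentre of `e`. -/
def barycentricSubdivision : Graph (Plane ⊕ G.E) (G.E × Bool) :=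
  graphOfEnds (Sum.inl '' G.V ∪ Set.range Sum.inr)
    (fun h => Sum.inl (G.endpoint h.1 h.2)) (fun h => Sum.inr h.1)
    (fun h => Or.inl ⟨_, G.endpoint_mem h.1 h.2, rfl⟩) (fun h => Or.inr ⟨h.1, rfl⟩)

/-- The subgraph of `G` obtained by removing the edges in `R` (and keeping all vertices). -/
def deleteEdges (R : Set G.E) : PlaneGraph where
  V := G.V
  finite_V := G.finite_V
  E := {e : G.E // e ∉ R}
  finite_E := have := G.finite_E; inferInstance
  arc e := G.arc e.1
  arc_zero_mem e := G.arc_zero_mem e.1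
  arc_one_mem e := G.arc_one_mem e.1
  arc_interior_notMem e := G.arc_interior_notMem e.1
  arc_interior_injective e e' s hs t ht h :=
    have h' := G.arc_interior_injective e.1 e'.1 s hs t ht h
    ⟨Subtype.ext h'.1, h'.2⟩

/-- A plane dual `G*` of `G`, drawn together with `G`: a plane graph with one vertex in each face
of `G` and one edge `e*` for each edge `e` of `G`, such that `e` and `e*` meet in exactly one point,
there are no further intersections between `G` and `G*`, and, symmetrically, each face of `G*`
contains exactly one vertex of `G`. -/
structure PlaneDual where
  /-- the dual graph `G*` -/
  dual : PlaneGraph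
  /-- the bijection `e ↦ e*` -/
  dualEdge : G.E ≃ dual.E
  /-- the unique intersection point of `e` and `e*` -/
  crossing : G.E → Plane
  arc_inter : ∀ e, Set.range (G.arc e) ∩ Set.range (dual.arc (dualEdge e)) = {crossing e}
  arc_disjoint : ∀ e e', e' ≠ dualEdge e →
    Disjoint (Set.range (G.arc e)) (Set.range (dual.arc e'))
  dual_vertex_notMem : ∀ v ∈ dual.V, v ∉ G.pointSet
  dual_vertex_in_face : ∀ f ∈ G.faces, ∃! v, v ∈ dual.V ∧ v ∈ f
  vertex_notMem : ∀ v ∈ G.V, v ∉ dual.pointSet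
  vertex_in_face : ∀ f ∈ dual.faces, ∃! v, v ∈ G.V ∧ v ∈ f

namespace PlaneDual

variable {G} (D : G.PlaneDual)

/-- The overlaid Tait graph `Γ(G)`, obtained by overlaying `G` with `G*`. Its vertices are the points
of `V(G) ∪ V(G*)` and the crossings `e ∩ e*`. Each edge of `G` or of `G*` is cut in two by its
crossing, and the edges of `Γ(G)` are the resulting half-edges of `G` (`Sum.inl`) and
of `G*` (`Sum.inr`). -/
def taitGraph : Graph Plane ((G.E × Bool) ⊕ (D.dual.E × Bool)) :=
  graphOfEnds (G.V ∪ D.dual.V ∪ Set.range D.crossing)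
    (Sum.elim (fun h => G.endpoint h.1 h.2) (fun h => D.dual.endpoint h.1 h.2))
    (Sum.elim (fun h => D.crossing h.1) (fun h => D.crossing (D.dualEdge.symm h.1)))
    (by
      rintro (h | h)
      · exact Or.inl (Or.inl (G.endpoint_mem h.1 h.2))
      · exact Or.inl (Or.inr (D.dual.endpoint_mem h.1 h.2)))
    (by
      rintro (h | h)
      · exact Or.inr ⟨h.1, rfl⟩
      · exact Or.inr ⟨D.dualEdge.symm h.1, rfl⟩)

open Classical in
/-- The natural colouring `ε_G` of the edges of `Γ(G)`: an edge is black (`1`) if one of its ends is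
a vertex of `G`, and white (`0`) otherwise, i.e. if one of its ends is a vertex of `G*`. -/
noncomputable def colouring (h : (G.E × Bool) ⊕ (D.dual.E × Bool)) : ZMod 2 :=
  if ∃ v ∈ G.V, D.taitGraph.Inc h v then 1 else 0

/-- The subgraph `G(m)` of `G`, for a set `m` of half-edges of `G*`: remove all the edges of `G`
such that the barycentre of the dual edge is matched by `m`. -/
def complementaryGraph (m : Finset (D.dual.E × Bool)) : PlaneGraph :=
  G.deleteEdges {e | ∃ h ∈ m, D.dual.barycentricSubdivision.Inc h (Sum.inr (D.dualEdge e))}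

end PlaneDual

end PlaneGraph

end TaitMatching

/-! The horizontal differential never removes a white vertex, so the complex in filtration degree
`k` splits according to the white part of a simplex. A matching on the Tait graph is a matching `m`
on `B(G*)` together with a matching on `B(G)` sharing no crossing with `m`. The second condition
says exactly that the black part uses only half-edges of `G(m)` (`isMatching_taitGraph_union`,
`exists_map_union_map_blackEmbedding`). Hence the block of `m` is spanned by the matchings on
`B(G(m))`, with degrees shifted by `|m| = k`.

If `k > 0`, the black part may be empty, since `m` alone is already a simplex; the block is
therefore the augmented complex of `M(B(G(m)))`, and reduced homology appears. If `G(m)` has no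
edges, only the empty black part remains, giving a single class in degree `k - 1`. If `k = 0`, the
only block is `m = ∅`; the empty simplex is excluded and ordinary homology results.

The algebra is isolated in `nonempty_homology_equiv_pi`, a statement about families of finite sets.
The drawing enters through the facts that distinct edges have distinct crossings and that vertices
of `G`, vertices of `G*` and crossings are different points. -/

namespace TaitMatching

/-! ### Homology of block decomposed complexes -/

/-! ### Homology of a product of three-term sequences -/

section LinearAlgebra

variable {R : Type*} [Ring R]

/-- The homology of `A → B → C` at `B`, as a quotient of the kernel. -/
abbrev MiddleHomology {A B C : Type*} [AddCommGroup A] [AddCommGroup B] [AddCommGroup C]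
    [Module R A] [Module R B] [Module R C] (f : A →ₗ[R] B) (g : B →ₗ[R] C) : Type _ :=
  LinearMap.ker g ⧸ (LinearMap.range f).comap (LinearMap.ker g).subtype

/-- If a pair of maps `A → B → C` is isomorphic to a product of pairs `A m → B m → C m`,
then its homology is the product of the homologies. -/
theorem nonempty_middleHomology_equiv_pi {ι : Type*} {A B C : Type*} {A' B' C' : ι → Type*}
    [AddCommGroup A] [AddCommGroup B] [AddCommGroup C] [Module R A] [Module R B] [Module R C]
    [∀ m, AddCommGroup (A' m)] [∀ m, AddCommGroup (B' m)] [∀ m, AddCommGroup (C' m)]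
    [∀ m, Module R (A' m)] [∀ m, Module R (B' m)] [∀ m, Module R (C' m)]
    (f : A →ₗ[R] B) (g : B →ₗ[R] C) (f' : ∀ m, A' m →ₗ[R] B' m) (g' : ∀ m, B' m →ₗ[R] C' m)
    (a : (∀ m, A' m) ≃ₗ[R] A) (b : (∀ m, B' m) ≃ₗ[R] B) (c : (∀ m, C' m) ≃ₗ[R] C)
    (hf : ∀ x, f (a x) = b fun m => f' m (x m)) (hg : ∀ x, g (b x) = c fun m => g' m (x m)) :
    Nonempty (MiddleHomology f g ≃ₗ[R] ∀ m, MiddleHomology (f' m) (g' m)) := by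
  have hker : ∀ x : LinearMap.ker g, ∀ m, g' m (b.symm x m) = 0 := by
    intro x m
    have h := hg (b.symm x)
    rw [b.apply_symm_apply, x.2, eq_comm, LinearEquiv.map_eq_zero_iff] at h
    exact congrFun h m
  let p : ∀ m, LinearMap.ker g →ₗ[R] LinearMap.ker (g' m) := fun m =>
    LinearMap.codRestrict _
      (LinearMap.proj m ∘ₗ b.symm.toLinearMap ∘ₗ (LinearMap.ker g).subtype) fun x => hker x m
  let q : LinearMap.ker g →ₗ[R] ∀ m, MiddleHomology (f' m) (g' m) :=
    LinearMap.pi fun m => Submodule.mkQ _ ∘ₗ p m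
  have hq : Function.Surjective q := by
    intro y
    choose z hz using fun m => Submodule.mkQ_surjective _ (y m)
    refine ⟨⟨b fun m => z m, ?_⟩, funext fun m => ?_⟩
    · rw [LinearMap.mem_ker, hg, LinearEquiv.map_eq_zero_iff]
      exact funext fun m => (z m).2
    · rw [← hz m]
      refine congrArg (Submodule.mkQ _) (Subtype.ext ?_)
      exact congrFun (b.symm_apply_apply fun m => (z m : B' m)) m
  -- A cycle dies in every factor iff each component is a boundary; componentwise preimages assemble
  -- through `a` into one preimage under `f`.
  have hkq : LinearMap.ker q = (LinearMap.range f).comap (LinearMap.ker g).subtype := by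
    ext x
    have h1 : x ∈ LinearMap.ker q ↔ ∀ m, b.symm x m ∈ LinearMap.range (f' m) := by
      rw [LinearMap.mem_ker, funext_iff]
      refine forall_congr' fun m => ?_
      exact Submodule.Quotient.mk_eq_zero _
    rw [h1, Submodule.mem_comap]
    constructor
    · intro h
      choose y hy using h
      refine ⟨a y, ?_⟩
      rw [hf, Submodule.subtype_apply, ← b.apply_symm_apply x.1]
      exact congrArg b (funext hy)
    · rintro ⟨y, hy⟩ m
      refine ⟨a.symm y m, ?_⟩
      rw [Submodule.subtype_apply] at hy
      rw [← hy, ← a.apply_symm_apply y, hf, b.symm_apply_apply, a.symm_apply_apply]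
  exact ⟨(Submodule.quotEquivOfEq _ _ hkq.symm).trans (q.quotKerEquivOfSurjective hq)⟩

end LinearAlgebra

/-! ### Homology of cell complexes and their block decompositions -/

section Cells

variable {α : Type}

/-- The homology of `cellComplex` in terms of the boundary maps. -/
theorem nonempty_homology_equiv (S : Set (Finset α)) (hS : S.OrdConnected) (i j k : ℤ)
    (hij : j + 1 = i) (hjk : k + 1 = j) :
    Nonempty ((cellComplex S hS).homology j ≃ₗ[F]
      MiddleHomology (boundaryMap S i j) (boundaryMap S j k)) := by
  have e := (cellComplex S hS).homologyIsoSc' i j k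
    (by rw [ChainComplex.prev, hij]) (by rw [ChainComplex.next, ← hjk]; simp)
  let K := (cellComplex S hS).sc' i j k
  have e2 := K.moduleCatHomologyIso
  have h : LinearMap.range K.moduleCatToCycles =
      (LinearMap.range (boundaryMap S i j)).comap
        (LinearMap.ker (boundaryMap S j k)).subtype := by
    ext x
    change _ ↔ x.1 ∈ LinearMap.range (boundaryMap S i j)
    constructor
    · rintro ⟨y, rfl⟩
      exact ⟨y, rfl⟩
    · rintro ⟨y, hy⟩
      exact ⟨y, Subtype.ext hy⟩
  exact ⟨((e ≪≫ e2).toLinearEquiv).trans (Submodule.quotEquivOfEq _ _ h)⟩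

theorem boundaryMap_single [DecidableEq α] (S : Set (Finset α)) (i j : ℤ) (σ : Cell S i) (c : F)
    [∀ v, Decidable (σ.1.erase v ∈ S ∧ ((σ.1.erase v).card : ℤ) = j + 1)] :
    boundaryMap S i j (Finsupp.single σ c) =
      c • ∑ v ∈ σ.1, if h : σ.1.erase v ∈ S ∧ ((σ.1.erase v).card : ℤ) = j + 1 then
        Finsupp.single (⟨σ.1.erase v, h⟩ : Cell S j) (1 : F) else 0 := by
  rw [boundaryMap, Finsupp.linearCombination_single]
  congr 1
  refine Finset.sum_congr (by congr!) fun v _ => ?_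
  congr!

end Cells

/-- Suppose that every member of `S` is uniquely of the form `a m ∪ j m '' τ` with `τ ∈ T m`, where
`a m` has `k` elements and is disjoint from the range of `j m`, and that removing an element of
`a m` from such a set leads out of `S`. Then the homology of `S` is the product of the homologies
of the families `T m`, shifted by `k`. -/
theorem nonempty_homology_equiv_pi {ι α : Type} [Finite ι] [DecidableEq α] {β : ι → Type}
    (S : Set (Finset α)) (hS : S.OrdConnected)
    (T : ∀ m, Set (Finset (β m))) (hT : ∀ m, (T m).OrdConnected)
    (a : ι → Finset α) (j : ∀ m, β m ↪ α) (k : ℕ)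
    (hcard : ∀ m, (a m).card = k)
    (hdisj : ∀ m x, j m x ∉ a m)
    (hmem : ∀ m (τ : Finset (β m)), a m ∪ τ.map (j m) ∈ S ↔ τ ∈ T m)
    (hex : ∀ σ ∈ S, ∃ m, ∃ τ : Finset (β m), a m ∪ τ.map (j m) = σ)
    (hinj : ∀ m m' τ τ', τ ∈ T m → τ' ∈ T m' →
      a m ∪ τ.map (j m) = a m' ∪ τ'.map (j m') → m = m')
    (herase : ∀ m, ∀ τ ∈ T m, ∀ v ∈ a m, (a m ∪ τ.map (j m)).erase v ∉ S) (i : ℤ) :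
    Nonempty ((cellComplex S hS).homology i ≃ₗ[F]
      ∀ m, (cellComplex (T m) (hT m)).homology (i - k)) := by
  classical
  have := Fintype.ofFinite ι
  have hdisj' : ∀ m (τ : Finset (β m)), Disjoint (a m) (τ.map (j m)) := by
    intro m τ
    rw [Finset.disjoint_right]
    intro x hx
    obtain ⟨y, -, rfl⟩ := Finset.mem_map.1 hx
    exact hdisj m y
  have hc : ∀ m (τ : Finset (β m)) (i : ℤ),
      (((a m ∪ τ.map (j m)).card : ℕ) : ℤ) = i + 1 ↔ (τ.card : ℤ) = i - k + 1 := by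
    intro m τ i
    rw [Finset.card_union_of_disjoint (hdisj' m τ), hcard, Finset.card_map]
    push_cast
    constructor <;> intro h <;> linarith
  let c : ∀ i : ℤ, ∀ m, Cell (T m) (i - k) → Cell S i := fun i m τ =>
    ⟨a m ∪ τ.1.map (j m), (hmem m τ.1).2 τ.2.1, (hc m τ.1 i).2 τ.2.2⟩
  -- The degree `i` cells of `S` are the disjoint union of the degree `i - k` cells of the `T m`, so
  -- the chain groups match basis to basis.
  have hbij : ∀ i : ℤ, Function.Bijective
      (fun p : Σ m, Cell (T m) (i - k) => c i p.1 p.2) := by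
    intro i
    constructor
    · rintro ⟨m, τ, hτ⟩ ⟨m', τ', hτ'⟩ h
      have h' : a m ∪ τ.map (j m) = a m' ∪ τ'.map (j m') := congrArg Subtype.val h
      obtain rfl := hinj m m' τ τ' hτ.1 hτ'.1 h'
      have h2 : τ.map (j m) = τ'.map (j m) := by
        rw [← Finset.union_sdiff_cancel_left (hdisj' m τ), h',
          Finset.union_sdiff_cancel_left (hdisj' m τ')]
      obtain rfl := Finset.map_injective _ h2
      rfl
    · rintro ⟨σ, hσ⟩
      obtain ⟨m, τ, rfl⟩ := hex σ hσ.1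
      exact ⟨⟨m, τ, (hmem m τ).1 hσ.1, (hc m τ i).1 hσ.2⟩, rfl⟩
  let Φ : ∀ i : ℤ, (∀ m, Cell (T m) (i - k) →₀ F) ≃ₗ[F] (Cell S i →₀ F) := fun i =>
    (Finsupp.sigmaFinsuppLEquivPiFinsupp F).symm.trans
      (Finsupp.domLCongr (Equiv.ofBijective _ (hbij i)))
  have hΦ : ∀ i m τ, Φ i (Pi.single m (Finsupp.single τ 1)) = Finsupp.single (c i m τ) 1 := by
    intro i m τ
    have h : (Finsupp.sigmaFinsuppLEquivPiFinsupp F).symm (Pi.single m (Finsupp.single τ (1 : F))) =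
        Finsupp.single (⟨m, τ⟩ : Σ m, Cell (T m) (i - k)) 1 := by
      rw [LinearEquiv.symm_apply_eq]
      ext m' τ'
      rw [Finsupp.sigmaFinsuppLEquivPiFinsupp_apply]
      by_cases hm : m' = m
      · subst hm
        simp [Finsupp.single_apply]
      · rw [Pi.single_eq_of_ne hm, Finsupp.single_eq_of_ne]
        · rfl
        · exact fun h => hm (Sigma.mk.inj_iff.1 h).1
    rw [LinearEquiv.trans_apply, h, Finsupp.domLCongr_single]
    rfl
  have hcomm : ∀ (i l : ℤ) x, boundaryMap S i l (Φ i x) =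
      Φ l fun m => boundaryMap (T m) (i - k) (l - k) (x m) := by
    intro i l
    suffices boundaryMap S i l ∘ₗ (Φ i).toLinearMap = (Φ l).toLinearMap ∘ₗ
        LinearMap.pi fun m => boundaryMap (T m) (i - k) (l - k) ∘ₗ LinearMap.proj m from
      fun x => LinearMap.congr_fun this x
    refine LinearMap.pi_ext' fun m => Finsupp.lhom_ext' fun τ => LinearMap.ext_ring ?_
    have hpi : (fun m' => boundaryMap (T m') (i - k) (l - k)
        ((Pi.single m (Finsupp.single τ (1 : F)) : ∀ m, Cell (T m) (i - k) →₀ F) m')) =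
        Pi.single m (boundaryMap (T m) (i - k) (l - k) (Finsupp.single τ 1)) := by
      funext m'
      by_cases hm : m' = m
      · subst hm
        simp
      · rw [Pi.single_eq_of_ne hm, Pi.single_eq_of_ne hm, map_zero]
    change boundaryMap S i l (Φ i (Pi.single m (Finsupp.single τ 1))) = Φ l fun m' =>
      boundaryMap (T m') (i - k) (l - k)
        ((Pi.single m (Finsupp.single τ (1 : F)) : ∀ m, Cell (T m) (i - k) →₀ F) m')
    rw [hpi, hΦ, boundaryMap_single, boundaryMap_single, one_smul, one_smul]
    change ∑ v ∈ a m ∪ τ.1.map (j m), _ = _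
    -- Faces omitting a vertex of `a m` leave `S` and contribute zero; those omitting a vertex of
    -- `τ` reproduce the boundary in `T m`.
    rw [Finset.sum_union (hdisj' m τ.1), Finset.sum_eq_zero, zero_add, Finset.sum_map]
    · change _ = ((Φ l).toLinearMap ∘ₗ LinearMap.single F _ m) _
      rw [map_sum]
      refine Finset.sum_congr rfl fun v _ => ?_
      have he : (a m ∪ τ.1.map (j m)).erase (j m v) = a m ∪ (τ.1.erase v).map (j m) := by
        rw [Finset.erase_union_distrib, Finset.erase_eq_of_notMem (hdisj m v), Finset.map_erase]
      have hcond : ((c i m τ).1.erase (j m v) ∈ S ∧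
            (((c i m τ).1.erase (j m v)).card : ℤ) = l + 1) ↔
          (τ.1.erase v ∈ T m ∧ ((τ.1.erase v).card : ℤ) = l - k + 1) := by
        rw [show (c i m τ).1.erase (j m v) = _ from he, hmem, hc]
      by_cases h : τ.1.erase v ∈ T m ∧ ((τ.1.erase v).card : ℤ) = l - k + 1
      · rw [dif_pos h, dif_pos (hcond.2 h)]
        refine Eq.trans ?_ (hΦ l m ⟨τ.1.erase v, h⟩).symm
        congr 1
        exact Subtype.ext he
      · rw [dif_neg h, dif_neg (fun h' => h (hcond.1 h')), map_zero]
    · intro v hv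
      exact dif_neg fun h => herase m τ.1 τ.2.1 v hv h.1
  obtain ⟨e₁⟩ := nonempty_homology_equiv S hS (i + 1) i (i - 1) rfl (by ring)
  have e₂ := fun m => nonempty_homology_equiv (T m) (hT m) (i + 1 - k) (i - k) (i - 1 - k)
    (by ring) (by ring)
  obtain ⟨e₃⟩ := nonempty_middleHomology_equiv_pi (boundaryMap S (i + 1) i)
    (boundaryMap S i (i - 1)) _ _ (Φ (i + 1)) (Φ i) (Φ (i - 1)) (hcomm _ _) (hcomm _ _)
  exact ⟨(e₁.trans e₃).trans (LinearEquiv.piCongrRight fun m => (e₂ m).some.symm)⟩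

/-- If the vertex type is empty, the reduced homology is one-dimensional and sits
in degree `-1`. -/
theorem nonempty_reducedHomology_equiv_lineInDegree {α : Type} [IsEmpty α]
    (X : PreAbstractSimplicialComplex α) (i a j : ℤ) (h : i = -1 ↔ j = a) :
    Nonempty (reducedHomology X i ≃ₗ[F] lineInDegree a j) := by
  have hcell : ∀ l : ℤ, l ≠ -1 → IsEmpty (Cell (insert ∅ X.faces) l) := by
    refine fun l hl => ⟨fun σ => hl ?_⟩
    have h1 := σ.2.2
    rw [Finset.eq_empty_of_isEmpty σ.1, Finset.card_empty] at h1
    push_cast at h1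
    linarith
  obtain ⟨e⟩ := nonempty_homology_equiv _ (ordConnected_insert_empty X) (i + 1) i (i - 1) rfl
    (by ring)
  by_cases hi : i = -1
  · obtain rfl := h.1 hi
    subst hi
    -- The empty set is the only cell, so both neighbouring chain groups vanish and the homology is
    -- the whole chain group in degree `-1`.
    have h0 := hcell (-1 + 1) (by norm_num)
    have h1 := hcell (-1 - 1) (by norm_num)
    let _ : Unique (Cell (insert ∅ X.faces) (-1)) :=
      { default := ⟨∅, Set.mem_insert _ _, by simp⟩
        uniq := fun σ => Subtype.ext (Finset.eq_empty_of_isEmpty σ.1) }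
    have hf : LinearMap.range (boundaryMap (insert ∅ X.faces) (-1 + 1) (-1)) = ⊥ := by
      rw [Subsingleton.elim (boundaryMap (insert ∅ X.faces) (-1 + 1) (-1)) 0, LinearMap.range_zero]
    have hg : LinearMap.ker (boundaryMap (insert ∅ X.faces) (-1) (-1 - 1)) = ⊤ := by
      rw [Subsingleton.elim (boundaryMap (insert ∅ X.faces) (-1) (-1 - 1)) 0, LinearMap.ker_zero]
    have e₁ : MiddleHomology (boundaryMap (insert ∅ X.faces) (-1 + 1) (-1))
        (boundaryMap (insert ∅ X.faces) (-1) (-1 - 1)) ≃ₗ[F] _ :=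
      Submodule.quotEquivOfEqBot _ (by rw [hf, Submodule.comap_bot, Submodule.ker_subtype])
    have e₂ := (LinearEquiv.ofTop _ hg).trans
      (Finsupp.uniqueLinearEquiv F F (default : Cell (insert ∅ X.faces) (-1)))
    exact ⟨((e.trans e₁).trans e₂).trans (LinearEquiv.ofTop _ (if_pos rfl)).symm⟩
  · have h0 := hcell i hi
    have hsub : Subsingleton (lineInDegree a j) := by
      rw [lineInDegree, if_neg fun hj => hi (h.2 hj)]
      infer_instance
    have : Subsingleton (MiddleHomology (boundaryMap (insert ∅ X.faces) (i + 1) i)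
      (boundaryMap (insert ∅ X.faces) i (i - 1))) := (Submodule.mkQ_surjective _).subsingleton
    exact ⟨e.trans (LinearEquiv.ofSubsingleton _ _)⟩

/-! ### Matchings on the overlaid Tait graph -/

theorem graphOfEnds_inc {α β : Type} (V : Set α) (a b : β → α) (ha : ∀ e, a e ∈ V)
    (hb : ∀ e, b e ∈ V) (e : β) (x : α) :
    (graphOfEnds V a b ha hb).Inc e x ↔ x = a e ∨ x = b e := by
  constructor
  · rintro ⟨y, ⟨h, -⟩ | ⟨h, -⟩⟩
    exacts [Or.inl h, Or.inr h]
  · rintro (h | h)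
    exacts [⟨_, Or.inl ⟨h, rfl⟩⟩, ⟨_, Or.inr ⟨h, rfl⟩⟩]

/-- By `hab` the graph is bipartite, with `a`-ends on one side and `b`-ends on the other, so two
edges can only meet `a`-end to `a`-end or `b`-end to `b`-end. For the subdivisions the `b`-ends are
barycentres; for the Tait graph they are crossings. -/
theorem isMatching_graphOfEnds {α β : Type} (V : Set α) (a b : β → α) (ha : ∀ e, a e ∈ V)
    (hb : ∀ e, b e ∈ V) (hab : ∀ e f, a e ≠ b f) (m : Finset β) :
    IsMatching (graphOfEnds V a b ha hb) m ↔
      ∀ e ∈ m, ∀ f ∈ m, e ≠ f → a e ≠ a f ∧ b e ≠ b f := by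
  simp only [IsMatching, graphOfEnds_inc]
  constructor
  · rintro ⟨-, h⟩ e he f hf hef
    exact ⟨fun h' => h e he f hf hef _ ⟨Or.inl rfl, Or.inl h'⟩,
      fun h' => h e he f hf hef _ ⟨Or.inr rfl, Or.inr h'⟩⟩
  · refine fun h => ⟨fun _ _ => trivial, fun e he f hf hef x hx => ?_⟩
    obtain ⟨h1, h2⟩ := h e he f hf hef
    obtain ⟨rfl | rfl, h3 | h3⟩ := hx
    exacts [h1 h3, hab _ _ h3, hab _ _ h3.symm, h2 h3]

/-! ### Matchings on barycentric subdivisions and deletion of edges -/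

namespace PlaneGraph

variable {G : PlaneGraph}

theorem isMatching_barycentricSubdivision (m : Finset (G.E × Bool)) :
    IsMatching G.barycentricSubdivision m ↔ ∀ h ∈ m, ∀ h' ∈ m, h ≠ h' →
      G.endpoint h.1 h.2 ≠ G.endpoint h'.1 h'.2 ∧ h.1 ≠ h'.1 := by
  refine (isMatching_graphOfEnds _ _ _ _ _ (fun _ _ => Sum.inl_ne_inr) _).trans ?_
  simp only [ne_eq, Sum.inl.injEq, Sum.inr.injEq]

/-- The half-edges of `G.deleteEdges R` as half-edges of `G`. -/
def halfEdgeEmbedding (R : Set G.E) : (G.deleteEdges R).E × Bool ↪ G.E × Bool :=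
  (Function.Embedding.subtype _).prodMap (Function.Embedding.refl _)

theorem mem_range_halfEdgeEmbedding (R : Set G.E) (h : G.E × Bool) :
    h ∈ Set.range (halfEdgeEmbedding R) ↔ h.1 ∉ R :=
  ⟨fun ⟨x, hx⟩ => hx ▸ x.1.2, fun hh => ⟨(⟨h.1, hh⟩, h.2), rfl⟩⟩

/-- Deletion changes no endpoint of a surviving half-edge, and the inclusion of edges is injective,
so conflicts are the same in both graphs. -/
theorem isMatching_deleteEdges (R : Set G.E) (m : Finset ((G.deleteEdges R).E × Bool)) :
    IsMatching (G.deleteEdges R).barycentricSubdivision m ↔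
      IsMatching G.barycentricSubdivision (m.map (halfEdgeEmbedding R)) := by
  rw [isMatching_barycentricSubdivision, isMatching_barycentricSubdivision]
  simp only [Finset.forall_mem_map, (halfEdgeEmbedding R).injective.ne_iff]
  refine forall₂_congr fun h _ => forall₃_congr fun h' _ _ => and_congr Iff.rfl ?_
  exact Subtype.coe_injective.ne_iff.symm

/-! ### Black and white parts of a matching on the Tait graph -/

namespace PlaneDual

variable (D : G.PlaneDual)

theorem crossing_mem (e : G.E) :
    D.crossing e ∈ Set.range (G.arc e) ∩ Set.range (D.dual.arc (D.dualEdge e)) := by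
  rw [D.arc_inter]
  rfl

theorem crossing_mem_pointSet (e : G.E) : D.crossing e ∈ G.pointSet :=
  Or.inr (Set.mem_iUnion.2 ⟨e, (D.crossing_mem e).1⟩)

theorem crossing_mem_dual_pointSet (e : G.E) : D.crossing e ∈ D.dual.pointSet :=
  Or.inr (Set.mem_iUnion.2 ⟨_, (D.crossing_mem e).2⟩)

/-- A crossing shared by distinct `e` and `e'` would lie on both `e` and the dual edge of `e'`,
which are disjoint. -/
theorem crossing_injective : Function.Injective D.crossing := by
  intro e e' h
  by_contra hne
  refine (D.arc_disjoint e (D.dualEdge e') ?_).le_bot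
    ⟨(D.crossing_mem e).1, h ▸ (D.crossing_mem e').2⟩
  exact fun h' => hne (D.dualEdge.injective h').symm

theorem ne_crossing_of_mem {v : Plane} (hv : v ∈ G.V) (e : G.E) : v ≠ D.crossing e :=
  fun h => D.vertex_notMem v hv (h ▸ D.crossing_mem_dual_pointSet e)

theorem ne_crossing_of_mem_dual {v : Plane} (hv : v ∈ D.dual.V) (e : G.E) : v ≠ D.crossing e :=
  fun h => D.dual_vertex_notMem v hv (h ▸ D.crossing_mem_pointSet e)

theorem ne_of_mem_of_mem_dual {v w : Plane} (hv : v ∈ G.V) (hw : w ∈ D.dual.V) : v ≠ w :=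
  fun h => D.dual_vertex_notMem w hw (h ▸ Or.inl hv)

/-- A set of edges of the overlaid Tait graph is a matching iff its black and white parts are
matchings on `B(G)` and `B(G*)` that do not meet in a crossing. -/
theorem isMatching_taitGraph (σ : Finset ((G.E × Bool) ⊕ (D.dual.E × Bool))) :
    IsMatching D.taitGraph σ ↔ IsMatching G.barycentricSubdivision σ.toLeft ∧
      IsMatching D.dual.barycentricSubdivision σ.toRight ∧
      ∀ h ∈ σ.toLeft, ∀ h' ∈ σ.toRight, h'.1 ≠ D.dualEdge h.1 := by
  rw [taitGraph, isMatching_graphOfEnds, isMatching_barycentricSubdivision,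
    isMatching_barycentricSubdivision]
  · simp only [Sum.forall, Sum.elim_inl, Sum.elim_inr, Finset.mem_toLeft, Finset.mem_toRight,
      D.crossing_injective.ne_iff, D.dualEdge.symm.injective.ne_iff, ne_eq, Sum.inl.injEq,
      Sum.inr.injEq, reduceCtorEq, not_false_eq_true, forall_const]
    constructor
    · refine fun H => ⟨fun h hh => (H.1 h hh).1, fun h hh => (H.2 h hh).2, fun h hh h' hh' he => ?_⟩
      refine ((H.1 h hh).2 h' hh').2 ?_
      rw [he, D.dualEdge.symm_apply_apply]
    · rintro ⟨H1, H2, H3⟩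
      refine ⟨fun h hh => ⟨H1 h hh, fun h' hh' => ⟨?_, ?_⟩⟩,
        fun h' hh' => ⟨fun h hh => ⟨?_, ?_⟩, H2 h' hh'⟩⟩
      · exact D.ne_of_mem_of_mem_dual (G.endpoint_mem _ _) (D.dual.endpoint_mem _ _)
      · rw [D.dualEdge.eq_symm_apply]
        exact fun he => H3 h hh h' hh' he.symm
      · exact (D.ne_of_mem_of_mem_dual (G.endpoint_mem _ _) (D.dual.endpoint_mem _ _)).symm
      · rw [D.dualEdge.symm_apply_eq]
        exact H3 h hh h' hh'
  · rintro (h | h) (h' | h')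
    exacts [D.ne_crossing_of_mem (G.endpoint_mem _ _) _, D.ne_crossing_of_mem (G.endpoint_mem _ _) _,
      D.ne_crossing_of_mem_dual (D.dual.endpoint_mem _ _) _,
      D.ne_crossing_of_mem_dual (D.dual.endpoint_mem _ _) _]

theorem colouring_inl (h : G.E × Bool) : D.colouring (Sum.inl h) = 1 :=
  if_pos ⟨_, G.endpoint_mem h.1 h.2, (graphOfEnds_inc _ _ _ _ _ _ _).2 (Or.inl rfl)⟩

/-- The two ends are a vertex of `G*` and a crossing, neither of which is a vertex of `G`. -/
theorem colouring_inr (h : D.dual.E × Bool) : D.colouring (Sum.inr h) = 0 := by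
  refine if_neg ?_
  rintro ⟨v, hv, hinc⟩
  obtain rfl | rfl := (graphOfEnds_inc _ _ _ _ _ _ _).1 hinc
  · exact D.ne_of_mem_of_mem_dual hv (D.dual.endpoint_mem h.1 h.2) rfl
  · exact D.ne_crossing_of_mem hv _ rfl

theorem weight_colouring (σ : Finset ((G.E × Bool) ⊕ (D.dual.E × Bool))) :
    weight D.colouring σ = σ.toRight.card := by
  rw [weight, ← Finset.card_map (s := σ.toRight) Function.Embedding.inr]
  refine congrArg Finset.card (Finset.ext ?_)
  rintro (h | h)
  · simp [colouring_inl]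
  · simp [colouring_inr]

/-- The half-edges of `G(m)` as half-edges of `G`. -/
def complementaryEmbedding (m : Finset (D.dual.E × Bool)) :
    (D.complementaryGraph m).E × Bool ↪ G.E × Bool :=
  halfEdgeEmbedding _

/-- The half-edges of `G(m)` as black edges of the overlaid Tait graph. -/
def blackEmbedding (m : Finset (D.dual.E × Bool)) :
    (D.complementaryGraph m).E × Bool ↪ (G.E × Bool) ⊕ (D.dual.E × Bool) :=
  (D.complementaryEmbedding m).trans Function.Embedding.inl

/-- A half-edge of `G*` is incident to the barycentre of `e*` precisely when it is a half of `e*`.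
This turns the definition of `G(m)` into the compatibility condition of `isMatching_taitGraph`. -/
theorem mem_range_blackEmbedding (m : Finset (D.dual.E × Bool)) (h : G.E × Bool) :
    Sum.inl h ∈ Set.range (D.blackEmbedding m) ↔ ∀ h' ∈ m, h'.1 ≠ D.dualEdge h.1 := by
  have h1 : Sum.inl h ∈ Set.range (D.blackEmbedding m) ↔
      h ∈ Set.range (halfEdgeEmbedding {e | ∃ h ∈ m,
        D.dual.barycentricSubdivision.Inc h (Sum.inr (D.dualEdge e))}) :=
    exists_congr fun x => Sum.inl_injective.eq_iff
  rw [h1, mem_range_halfEdgeEmbedding, Set.mem_ofPred_eq, not_exists]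
  refine forall_congr' fun h' => ?_
  rw [not_and]
  refine imp_congr_right fun _ => not_congr ((graphOfEnds_inc _ _ _ _ _ _ _).trans ?_)
  simp [eq_comm]

open Classical in
theorem toRight_map_union_map_blackEmbedding (m : Finset (D.dual.E × Bool))
    (τ : Finset ((D.complementaryGraph m).E × Bool)) :
    (m.map Function.Embedding.inr ∪ τ.map (D.blackEmbedding m)).toRight = m := by
  ext h
  simp [blackEmbedding]

open Classical in
/-- The matchings on the overlaid Tait graph with white part `m` are given by the matchings
on `B(G(m))`. -/
theorem isMatching_taitGraph_union (m : Finset (D.dual.E × Bool))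
    (τ : Finset ((D.complementaryGraph m).E × Bool)) :
    IsMatching D.taitGraph (m.map Function.Embedding.inr ∪ τ.map (D.blackEmbedding m)) ↔
      IsMatching D.dual.barycentricSubdivision m ∧
        IsMatching (D.complementaryGraph m).barycentricSubdivision τ := by
  have hl : (m.map Function.Embedding.inr ∪ τ.map (D.blackEmbedding m)).toLeft =
      τ.map (D.complementaryEmbedding m) := by
    ext h
    simp [blackEmbedding]
  rw [isMatching_taitGraph, toRight_map_union_map_blackEmbedding, hl, and_comm (b := _ ∧ _),
    and_assoc]
  refine and_congr_right fun _ => ?_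
  -- Avoidance of the crossings used by `m` is automatic for half-edges of `G(m)`.
  refine Iff.trans (and_iff_right ?_) (isMatching_deleteEdges _ τ).symm
  intro h hh h' hh'
  obtain ⟨x, -, rfl⟩ := Finset.mem_map.1 hh
  exact (D.mem_range_blackEmbedding m _).1 ⟨x, rfl⟩ h' hh'

open Classical in
theorem exists_map_union_map_blackEmbedding (σ : Finset ((G.E × Bool) ⊕ (D.dual.E × Bool)))
    (hσ : IsMatching D.taitGraph σ) :
    ∃ τ : Finset ((D.complementaryGraph σ.toRight).E × Bool),
      σ.toRight.map Function.Embedding.inr ∪ τ.map (D.blackEmbedding σ.toRight) = σ := by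
  refine ⟨σ.preimage (D.blackEmbedding σ.toRight) (D.blackEmbedding _).injective.injOn, ?_⟩
  have hd := ((D.isMatching_taitGraph σ).1 hσ).2.2
  ext x
  rw [Finset.mem_union, Finset.mem_map, Finset.mem_map]
  constructor
  · rintro (⟨h, hh, rfl⟩ | ⟨h, hh, rfl⟩)
    · exact Finset.mem_toRight.1 hh
    · exact Finset.mem_preimage.1 hh
  · intro hx
    obtain h | h := x
    -- No black edge is lost in the preimage: sharing no crossing with the white part, it survives
    -- in `G(m)`.
    · obtain ⟨y, hy⟩ := (D.mem_range_blackEmbedding σ.toRight h).2 fun h' hh' =>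
        hd h (Finset.mem_toLeft.2 hx) h' hh'
      exact Or.inr ⟨y, Finset.mem_preimage.2 (hy ▸ hx), hy⟩
    · exact Or.inl ⟨h, Finset.mem_toRight.2 hx, rfl⟩

end PlaneDual

end PlaneGraph

theorem isMatching_empty {α β : Type} (H : Graph α β) : IsMatching H ∅ :=
  ⟨by simp, by simp⟩

theorem mem_insert_empty_matchingComplex {α β : Type} (H : Graph α β) (m : Finset β) :
    m ∈ insert ∅ (matchingComplex H).faces ↔ IsMatching H m := by
  constructor
  · rintro (rfl | h)
    exacts [isMatching_empty H, h.2]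
  · intro h
    obtain rfl | hm := m.eq_empty_or_nonempty
    exacts [Or.inl rfl, Or.inr ⟨hm, h⟩]

/-! ### Splitting of the horizontal complex by white parts -/

namespace PlaneGraph.PlaneDual

variable {G : PlaneGraph} (D : G.PlaneDual)

open Classical in
/-- The horizontal homology in positive filtration degree `k` is the product, over the matchings `m`
of size `k` on `B(G*)`, of the shifted reduced homologies of `M(B(G(m)))`. -/
theorem nonempty_horizontalHomology_equiv_pi {ι : Type} (μ : ι → Finset (D.dual.E × Bool))
    (hμ : Function.Injective μ) {k : ℕ} (hk : 0 < k)
    (hμm : ∀ m, (∃ p, μ p = m) ↔ IsMatching D.dual.barycentricSubdivision m ∧ m.card = k) (i : ℤ) :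
    Nonempty (horizontalHomology (matchingComplex D.taitGraph) D.colouring k i ≃ₗ[F]
      ∀ p, reducedHomology (matchingComplex
        (D.complementaryGraph (μ p)).barycentricSubdivision) (i - k)) := by
  have := D.dual.finite_E
  have := Finite.of_injective μ hμ
  have hcard : ∀ p, (μ p).card = k := fun p => ((hμm _).1 ⟨p, rfl⟩).2
  refine nonempty_homology_equiv_pi _ _
    (fun p => insert ∅ (matchingComplex (D.complementaryGraph (μ p)).barycentricSubdivision).faces)
    _ (fun p => (μ p).map Function.Embedding.inr) (fun p => D.blackEmbedding (μ p)) k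
    (fun p => by rw [Finset.card_map, hcard]) (fun p x => by simp [blackEmbedding]) ?_ ?_ ?_ ?_ i
  · intro p τ
    rw [mem_insert_empty_matchingComplex, Set.mem_ofPred_eq, weight_colouring,
      toRight_map_union_map_blackEmbedding]
    refine ⟨fun h => ((D.isMatching_taitGraph_union _ _).1 h.1.2).2, fun h => ⟨⟨?_, ?_⟩, hcard p⟩⟩
    -- Since `k > 0`, the white part alone makes the simplex nonempty, so `τ = ∅` is allowed; this
    -- is the source of the augmentation.
    · refine Finset.Nonempty.inl (Finset.Nonempty.map ?_)
      rw [← Finset.card_pos, hcard]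
      exact hk
    · exact (D.isMatching_taitGraph_union _ _).2 ⟨((hμm _).1 ⟨p, rfl⟩).1, h⟩
  · rintro σ ⟨⟨-, hσ⟩, hw⟩
    rw [weight_colouring] at hw
    obtain ⟨p, hp⟩ := (hμm _).2 ⟨((D.isMatching_taitGraph σ).1 hσ).2.1, hw⟩
    refine ⟨p, ?_⟩
    rw [hp]
    exact D.exists_map_union_map_blackEmbedding σ hσ
  · intro p p' τ τ' _ _ h
    refine hμ ?_
    rw [← D.toRight_map_union_map_blackEmbedding (μ p) τ, h,
      D.toRight_map_union_map_blackEmbedding]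
  · rintro p τ - v hv ⟨-, hw⟩
    obtain ⟨h, hh, rfl⟩ := Finset.mem_map.1 hv
    rw [weight_colouring] at hw
    have he : ((((μ p).map Function.Embedding.inr ∪ τ.map (D.blackEmbedding (μ p))).erase
        (Function.Embedding.inr h)).toRight) = (μ p).erase h := by
      ext x
      simp [blackEmbedding]
    -- Erasing a white vertex lowers the weight to `k - 1`, which differs from `k` because `k > 0`.
    rw [he, Finset.card_erase_of_mem hh, hcard] at hw
    omega

open Classical in
/-- The horizontal homology in filtration degree `0` is the homology of `M(B(G))`. -/
theorem nonempty_horizontalHomology_zero_equiv (i : ℤ) :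
    Nonempty (horizontalHomology (matchingComplex D.taitGraph) D.colouring 0 i ≃ₗ[F]
      simplicialHomology (matchingComplex G.barycentricSubdivision) i) := by
  have hr : ∀ τ : Finset (G.E × Bool),
      (∅ ∪ τ.map (Function.Embedding.inl (β := D.dual.E × Bool))).toRight = ∅ := by
    intro τ
    ext h
    simp
  have hl : ∀ τ : Finset (G.E × Bool),
      (∅ ∪ τ.map (Function.Embedding.inl (β := D.dual.E × Bool))).toLeft = τ := by
    intro τ
    ext h
    simp
  have hmem : ∀ τ : Finset (G.E × Bool), ∅ ∪ τ.map Function.Embedding.inl ∈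
      {σ | σ ∈ (matchingComplex D.taitGraph).faces ∧ weight D.colouring σ = 0} ↔
      τ ∈ (matchingComplex G.barycentricSubdivision).faces := by
    intro τ
    rw [Set.mem_ofPred_eq, weight_colouring, hr, Finset.card_empty, and_iff_left rfl]
    change Finset.Nonempty _ ∧ IsMatching _ _ ↔ Finset.Nonempty _ ∧ IsMatching _ _
    rw [isMatching_taitGraph, hr, hl, Finset.empty_union, Finset.map_nonempty]
    simp [isMatching_empty]
  have hex : ∀ σ ∈ {σ | σ ∈ (matchingComplex D.taitGraph).faces ∧ weight D.colouring σ = 0},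
      ∃ _ : Unit, ∃ τ : Finset (G.E × Bool), ∅ ∪ τ.map Function.Embedding.inl = σ := by
    rintro σ ⟨-, hw⟩
    rw [weight_colouring, Finset.card_eq_zero] at hw
    refine ⟨(), σ.toLeft, ?_⟩
    ext (h | h)
    · simp
    · simp [← Finset.mem_toRight, hw]
  -- There is one block, with empty white part and no shift; its family omits `∅`, so the homology
  -- is unreduced.
  obtain ⟨e⟩ := nonempty_homology_equiv_pi _ (ordConnected_weight _ _ _)
    (fun _ : Unit => (matchingComplex G.barycentricSubdivision).faces)
    (fun _ => ordConnected_faces _) (fun _ => ∅) (fun _ => Function.Embedding.inl) 0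
    (fun _ => rfl) (fun _ _ => Finset.notMem_empty _) (fun _ => hmem) hex
    (fun _ _ _ _ _ _ _ => rfl) (fun _ _ _ _ hv => absurd hv (Finset.notMem_empty _)) i
  rw [Nat.cast_zero, sub_zero] at e
  exact ⟨e.trans (LinearEquiv.funUnique Unit F _)⟩

end PlaneGraph.PlaneDual

end TaitMatching

/-! ### Separation of the summands with `G(m)` empty and nonempty -/

theorem mainTheorem4 (G : TaitMatching.PlaneGraph) (hG : G.Connected) (D : G.PlaneDual) :
    (∀ k : ℕ, 0 < k → ∀ i : ℤ, Nonempty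
      (TaitMatching.horizontalHomology (TaitMatching.matchingComplex D.taitGraph) D.colouring k i
        ≃ₗ[TaitMatching.F]
        (⨁ m : {m : Finset (D.dual.E × Bool) //
              TaitMatching.IsMatching D.dual.barycentricSubdivision m ∧ m.card = k ∧
              Nonempty (D.complementaryGraph m).E},
            TaitMatching.reducedHomology (TaitMatching.matchingComplex
              (D.complementaryGraph m.1).barycentricSubdivision) (i - k)) ×
        (⨁ _m : {m : Finset (D.dual.E × Bool) //
              TaitMatching.IsMatching D.dual.barycentricSubdivision m ∧ m.card = k ∧
              IsEmpty (D.complementaryGraph m).E},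
            TaitMatching.lineInDegree ((k : ℤ) - 1) i))) ∧
    (∀ i : ℤ, Nonempty
      (TaitMatching.horizontalHomology (TaitMatching.matchingComplex D.taitGraph) D.colouring 0 i
        ≃ₗ[TaitMatching.F]
        TaitMatching.simplicialHomology (TaitMatching.matchingComplex
          G.barycentricSubdivision) i)) := by
  classical
  refine ⟨fun k hk i => ?_, D.nonempty_horizontalHomology_zero_equiv⟩
  have := D.dual.finite_E
  let I₁ := {m : Finset (D.dual.E × Bool) //
    TaitMatching.IsMatching D.dual.barycentricSubdivision m ∧ m.card = k ∧
      Nonempty (D.complementaryGraph m).E}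
  let I₂ := {m : Finset (D.dual.E × Bool) //
    TaitMatching.IsMatching D.dual.barycentricSubdivision m ∧ m.card = k ∧
      IsEmpty (D.complementaryGraph m).E}
  have := Fintype.ofFinite I₁
  have := Fintype.ofFinite I₂
  -- Indexing the matchings of size `k` by a sum type makes the product over all of them split into
  -- the two required factors.
  let μ : I₁ ⊕ I₂ → Finset (D.dual.E × Bool) := Sum.elim Subtype.val Subtype.val
  have hμ : Function.Injective μ := by
    refine Subtype.val_injective.sumElim Subtype.val_injective fun a b h => ?_
    have ha := a.2.2.2
    rw [h] at ha
    exact not_isEmpty_iff.2 ha b.2.2.2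
  obtain ⟨e⟩ := D.nonempty_horizontalHomology_equiv_pi μ hμ hk (fun m => by
    constructor
    · rintro ⟨p | p, rfl⟩
      exacts [⟨p.2.1, p.2.2.1⟩, ⟨p.2.1, p.2.2.1⟩]
    · rintro ⟨h1, h2⟩
      obtain h | h := isEmpty_or_nonempty (D.complementaryGraph m).E
      exacts [⟨Sum.inr ⟨m, h1, h2, h⟩, rfl⟩, ⟨Sum.inl ⟨m, h1, h2, h⟩, rfl⟩]) i
  -- Here `M(B(G(m)))` has no vertices, and its class in degree `i - k = -1` lies in degree `i = k -
  -- 1`.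
  have e₂ := fun m : I₂ =>
    have := m.2.2.2
    TaitMatching.nonempty_reducedHomology_equiv_lineInDegree (TaitMatching.matchingComplex
      (D.complementaryGraph m.1).barycentricSubdivision) (i - k) (k - 1) i
      ⟨fun h => by linarith, fun h => by linarith⟩
  exact ⟨(e.trans (LinearEquiv.sumPiEquivProdPi _ _ _ _)).trans (LinearEquiv.prodCongr
    (DirectSum.linearEquivFunOnFintype TaitMatching.F I₁ fun m =>
      TaitMatching.reducedHomology (TaitMatching.matchingComplex
        (D.complementaryGraph m.1).barycentricSubdivision) (i - k)).symm
    ((LinearEquiv.piCongrRight fun m => (e₂ m).some).trans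
      (DirectSum.linearEquivFunOnFintype _ _ _).symm))⟩
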